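/- Let $\mathrm{Cat}(\mathrm{Ab})$ be the category of small $\mathrm{Ab}$-enriched (i.e. preadditive) categories and $\mathrm{Ab}$-enriched (i.e. additive) functors. It is a symmetric monoidal closed category: $\mathcal A\otimes\mathcal B$ has as objects the pairs $(a,b)$ of objects and as morphism groups $(\mathcal A\otimes\mathcal B)((a,b),(a',b'))=\mathcal A(a,a')\otimes_{\mathbb Z}\mathcal B(b,b')$; the unit is $\underline{\mathbb Z}$; the internal hom $\mathcal B^{\mathcal A}$ has as objects the additive functors $\mathcal A\to\mathcal B$ and as morphism groups the groups of natural transformations between them. In particular $\mathrm{Cat}(\mathrm{Ab})$ is enriched in itself. For a ring $S$, $\underline S$ denotes the $\mathrm{Ab}$-enriched category with one object whose endomorphism ring is $S$. Let $R$ be a commutative ring with unit. Then $\underline R$ is a commutative monoid in $\mathrm{Cat}(\mathrm{Ab})$, with multiplication $\underline R\otimes\underline R\to\underline R$ induced by that of $R$ and unit $\underline{\mathbb Z}\to\underline R$ induced by $\mathbb Z\to R$. Let $\underline{\underline R}$ be the $\mathrm{Cat}(\mathrm{Ab})$-enriched category with one object $*$, with $\underline{\underline R}(*,*)=\underline R$,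 and with composition and identity given by the multiplication and the unit of $\underline R$. Let * $\mathrm{Fun}^{\mathrm{Cat}(\mathrm{Ab})}(\underline{\underline R},\mathrm{Cat}(\mathrm{Ab}))$ be the category of $\mathrm{Cat}(\mathrm{Ab})$-enriched functors $\underline{\underline R}\to\mathrm{Cat}(\mathrm{Ab})$ and $\mathrm{Cat}(\mathrm{Ab})$-enriched natural transformations; such a transformation $\alpha:F\Rightarrow G$ is given by one morphism $\underline{\mathbb Z}\to G(*)^{F(*)}$, that is, by an additive functor $\alpha:F(*)\to G(*)$, such that $F_{**}:\underline R\to F(*)^{F(*)}$ followed by postcomposition with $\alpha$ equals $G_{**}:\underline R\to G(*)^{G(*)}$ followed by precomposition with $\alpha$, as morphisms $\underline R\to G(*)^{F(*)}$; * $\mathrm{LMod}_{\underline R}(\mathrm{Cat}(\mathrm{Ab}))$ be the category of pairs $(\mathcal A,\ m_{\mathcal A}:\underline R\otimes\mathcal A\to\mathcal A)$ with $\mathcal A$ in $\mathrm{Cat}(\mathrm{Ab})$ and $m_{\mathcal A}$ an associative and unital action of the monoid $\underline R$, and of morphisms $f:\mathcal A\to\mathcal B$ in $\mathrm{Cat}(\mathrm{Ab})$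 with $f\circ m_{\mathcal A}=m_{\mathcal B}\circ(\underline R\otimes f)$. Then there is an equivalence of categories $$\gamma:\ \mathrm{Fun}^{\mathrm{Cat}(\mathrm{Ab})}(\underline{\underline R},\mathrm{Cat}(\mathrm{Ab}))\ \simeq\ \mathrm{LMod}_{\underline R}(\mathrm{Cat}(\mathrm{Ab})).$$ It sends an enriched functor $F$ to $(F(*),m_{F(*)})$, where $m_{F(*)}:\underline R\otimes F(*)\to F(*)$ corresponds to $F_{**}:\underline R\to F(*)^{F(*)}$ under the adjunction $-\otimes F(*)\dashv(-)^{F(*)}$, and it sends an enriched natural transformation $\alpha:F\Rightarrow G$ to the underlying additive functor $\alpha:F(*)\to G(*)$. It has a quasi-inverse that sends $(\mathcal A,m_{\mathcal A})$ to an enriched functor with value $\mathcal A$ at $*$ whose morphism $\underline R\to\mathcal A^{\mathcal A}$ corresponds to $m_{\mathcal A}$ under the adjunction $-\otimes\mathcal A\dashv(-)^{\mathcal A}$. -/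

import Mathlib

open CategoryTheory MonoidalCategory TensorProduct

universe u

noncomputable section

namespace CatAb

/-! ### Tensor product of preadditive categories -/

section Tensor

variable (C D : Type u) [Category.{u} C] [Category.{u} D] [Preadditive C] [Preadditive D]

/-- Composition in a preadditive category as a `ℤ`-bilinear map. -/
def compL {C : Type u} [Category.{u} C] [Preadditive C] (X Y Z : C) :
    (X ⟶ Y) →ₗ[ℤ] (Y ⟶ Z) →ₗ[ℤ] (X ⟶ Z) :=
  LinearMap.mk₂ ℤ (fun f g => f ≫ g) (fun _ _ _ => Preadditive.add_comp _ _ _ _ _ _)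
    (fun _ _ _ => Preadditive.zsmul_comp _ _ _) (fun _ _ _ => Preadditive.comp_add _ _ _ _ _ _)
    (fun _ _ _ => Preadditive.comp_zsmul _ _ _)

/-- Objects of the tensor product of two preadditive categories: pairs of objects. -/
structure Tens : Type u where
  fst : C
  snd : D

variable {C D}

/-- Composition of the tensor product: `(f ⊗ g) ≫ (f' ⊗ g') = (f ≫ f') ⊗ (g ≫ g')`. -/
def Tens.compL (X Y Z : Tens C D) :
    ((X.fst ⟶ Y.fst) ⊗[ℤ] (X.snd ⟶ Y.snd)) →ₗ[ℤ] ((Y.fst ⟶ Z.fst) ⊗[ℤ] (Y.snd ⟶ Z.snd)) →ₗ[ℤ]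
      ((X.fst ⟶ Z.fst) ⊗[ℤ] (X.snd ⟶ Z.snd)) :=
  TensorProduct.map₂ (CatAb.compL _ _ _) (CatAb.compL _ _ _)

theorem Tens.compL_tmul {X Y Z : Tens C D} (f : X.fst ⟶ Y.fst) (g : X.snd ⟶ Y.snd)
    (f' : Y.fst ⟶ Z.fst) (g' : Y.snd ⟶ Z.snd) :
    Tens.compL X Y Z (f ⊗ₜ g) (f' ⊗ₜ g') = (f ≫ f') ⊗ₜ (g ≫ g') := rfl

instance : Category.{u} (Tens C D) where
  Hom X Y := (X.fst ⟶ Y.fst) ⊗[ℤ] (X.snd ⟶ Y.snd)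
  id X := 𝟙 X.fst ⊗ₜ 𝟙 X.snd
  comp {X Y Z} f g := Tens.compL X Y Z f g
  id_comp {X Y} f := by
    induction f using TensorProduct.induction_on with
    | zero => simp
    | tmul a b => simp [Tens.compL_tmul]
    | add a b ha hb => rw [map_add, ha, hb]
  comp_id {X Y} f := by
    induction f using TensorProduct.induction_on with
    | zero => simp
    | tmul a b => simp [Tens.compL_tmul]
    | add a b ha hb => rw [map_add, LinearMap.add_apply, ha, hb]
  assoc {W X Y Z} f g h := by
    induction f using TensorProduct.induction_on with
    | zero => simp
    | add a b ha hb => simp only [map_add, LinearMap.add_apply, ha, hb]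
    | tmul a b =>
      induction g using TensorProduct.induction_on with
      | zero => simp
      | add a b ha hb => simp only [map_add, LinearMap.add_apply, ha, hb]
      | tmul a' b' =>
        induction h using TensorProduct.induction_on with
        | zero => simp
        | add a b ha hb => simp only [map_add, ha, hb]
        | tmul a'' b'' => simp [Tens.compL_tmul]

instance : Preadditive (Tens C D) where
  homGroup X Y := inferInstanceAs (AddCommGroup ((X.fst ⟶ Y.fst) ⊗[ℤ] (X.snd ⟶ Y.snd)))
  add_comp X Y Z f f' g := LinearMap.map_add₂ (Tens.compL X Y Z) f f' g
  comp_add X Y Z f g g' := LinearMap.map_add (Tens.compL X Y Z f) g g'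

namespace Tens

/-- The pure tensor `f ⊗ g`, as a morphism of the tensor product category. -/
def tmul {X Y : Tens C D} (f : X.fst ⟶ Y.fst) (g : X.snd ⟶ Y.snd) : X ⟶ Y :=
  f ⊗ₜ[ℤ] g

theorem id_eq (X : Tens C D) : 𝟙 X = tmul (𝟙 X.fst) (𝟙 X.snd) := rfl

theorem tmul_comp {X Y Z : Tens C D} (f : X.fst ⟶ Y.fst) (g : X.snd ⟶ Y.snd)
    (f' : Y.fst ⟶ Z.fst) (g' : Y.snd ⟶ Z.snd) :
    (tmul f g : X ⟶ Y) ≫ (tmul f' g' : Y ⟶ Z) = tmul (f ≫ f') (g ≫ g') := rfl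

theorem add_tmul {X Y : Tens C D} (f f' : X.fst ⟶ Y.fst) (g : X.snd ⟶ Y.snd) :
    (tmul (f + f') g : X ⟶ Y) = tmul f g + tmul f' g := TensorProduct.add_tmul _ _ _

theorem tmul_add {X Y : Tens C D} (f : X.fst ⟶ Y.fst) (g g' : X.snd ⟶ Y.snd) :
    (tmul f (g + g') : X ⟶ Y) = tmul f g + tmul f g' := TensorProduct.tmul_add _ _ _

theorem hom_induction {X Y : Tens C D} {p : (X ⟶ Y) → Prop} (t : X ⟶ Y)
    (h : ∀ f g, p (tmul f g)) (hadd : ∀ s t, p s → p t → p (s + t)) : p t := by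
  refine TensorProduct.induction_on (motive := p) t ?_ h hadd
  have := h 0 0
  rwa [show (tmul 0 0 : X ⟶ Y) = (0 : (X.fst ⟶ Y.fst) ⊗[ℤ] (X.snd ⟶ Y.snd)) from
    TensorProduct.zero_tmul _ _] at this

variable {E : Type u} [Category.{u} E] [Preadditive E]

/-- The additive map out of the morphism groups of the tensor product given by a biadditive map. -/
def liftHom {X Y : Tens C D} {G : Type u} [AddCommGroup G]
    (φ : (X.fst ⟶ Y.fst) → (X.snd ⟶ Y.snd) → G)
    (hl : ∀ f f' g, φ (f + f') g = φ f g + φ f' g)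
    (hr : ∀ f g g', φ f (g + g') = φ f g + φ f g') : (X ⟶ Y) →+ G :=
  TensorProduct.liftAddHom
    (AddMonoidHom.mk' (fun f => AddMonoidHom.mk' (φ f) (hr f)) (fun f f' => by ext; apply hl))
    (fun r f g => by
      rw [map_zsmul, map_zsmul, AddMonoidHom.coe_smul, Pi.smul_apply])

theorem liftHom_tmul {X Y : Tens C D} {G : Type u} [AddCommGroup G]
    (φ : (X.fst ⟶ Y.fst) → (X.snd ⟶ Y.snd) → G) (hl hr) (f : X.fst ⟶ Y.fst) (g : X.snd ⟶ Y.snd) :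
    liftHom (X := X) (Y := Y) φ hl hr (tmul f g) = φ f g := rfl

/-- A functor out of the tensor product, given on morphisms by additive maps that are functorial on
pure tensors. -/
def desc (obj : Tens C D → E) (map : ∀ X Y : Tens C D, (X ⟶ Y) →+ (obj X ⟶ obj Y))
    (map_id : ∀ X : Tens C D, map X X (tmul (𝟙 _) (𝟙 _)) = 𝟙 (obj X))
    (map_comp : ∀ (X Y Z : Tens C D) (f : X.fst ⟶ Y.fst) (g : X.snd ⟶ Y.snd) (f' : Y.fst ⟶ Z.fst)
      (g' : Y.snd ⟶ Z.snd), map X Z (tmul (f ≫ f') (g ≫ g')) =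
        map X Y (tmul f g) ≫ map Y Z (tmul f' g')) : Tens C D ⥤ E where
  obj := obj
  map {X Y} f := map X Y f
  map_id := map_id
  map_comp {X Y Z} s t := by
    induction s using hom_induction with
    | hadd s s' hs hs' => simp only [Preadditive.add_comp, _root_.map_add, hs, hs']
    | h f g =>
      induction t using hom_induction with
      | hadd s s' hs hs' => simp only [Preadditive.comp_add, _root_.map_add, hs, hs']
      | h f' g' => exact map_comp X Y Z f g f' g'

end Tens

end Tensor

/-! ### The one-object preadditive category of a ring -/

/-- The preadditive category `R̲` with a single object, with endomorphism ring `R`, and with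
composition the multiplication of `R`. -/
def OneObj (_R : Type u) : Type u := PUnit.{u + 1}

namespace OneObj

/-- The object of `OneObj R`. -/
def star (R : Type u) : OneObj R := PUnit.unit

variable {R : Type u} [Ring R]

instance : Category.{u} (OneObj R) where
  Hom _ _ := R
  id _ := (1 : R)
  comp f g := (f * g : R)
  id_comp := one_mul (M := R)
  comp_id := mul_one (M := R)
  assoc := mul_assoc (G := R)

instance : Preadditive (OneObj R) where
  homGroup _ _ := inferInstanceAs (AddCommGroup R)
  add_comp _ _ _ := add_mul (R := R)
  comp_add _ _ _ := mul_add (R := R)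

/-- An element of `R` as a morphism of `OneObj R`. -/
def ofRing {X Y : OneObj R} : R →+ (X ⟶ Y) := AddMonoidHom.id R

/-- A morphism of `OneObj R` as an element of `R`. -/
def toRing {X Y : OneObj R} : (X ⟶ Y) →+ R := AddMonoidHom.id R

@[simp] theorem ofRing_toRing {X Y : OneObj R} (f : X ⟶ Y) : ofRing (toRing f) = f := rfl

@[simp] theorem toRing_ofRing {X Y : OneObj R} (r : R) :
    toRing (ofRing r : X ⟶ Y) = r := rfl

@[simp] theorem toRing_id (X : OneObj R) : toRing (𝟙 X) = 1 := rfl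

@[simp] theorem toRing_comp {X Y Z : OneObj R} (f : X ⟶ Y) (g : Y ⟶ Z) :
    toRing (f ≫ g) = toRing f * toRing g := rfl

theorem ofRing_one (X : OneObj R) : (ofRing 1 : X ⟶ X) = 𝟙 X := rfl

theorem ofRing_mul (X Y Z : OneObj R) (r s : R) :
    (ofRing (r * s) : X ⟶ Z) = (ofRing r : X ⟶ Y) ≫ ofRing s := rfl

theorem zsmul_id {X Y : OneObj (ULift.{u} ℤ)} (n : X ⟶ Y) :
    (toRing n).down • 𝟙 (star (ULift.{u} ℤ)) = n :=
  ULift.down_injective (mul_one (toRing n).down)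

end OneObj

end CatAb

/-! ### The category of small preadditive categories -/

/-- A small category enriched in abelian groups. -/
structure CatAb : Type (u + 1) where
  /-- The type of objects. -/
  carrier : Type u
  [category : Category.{u} carrier]
  [preadditive : Preadditive carrier]

namespace CatAb

instance : CoeSort CatAb.{u} (Type u) := ⟨carrier⟩

attribute [instance] category preadditive

/-- An additive functor, that is, a functor enriched in abelian groups. -/
@[ext]
structure Hom (C D : CatAb.{u}) : Type u where
  /-- The underlying functor. -/
  functor : C ⥤ D
  [additive : functor.Additive]

attribute [instance] Hom.additive

/-- The category `Cat(Ab)` of small preadditive categories and additive functors. -/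
instance : Category.{u} CatAb.{u} where
  Hom := Hom
  id C := ⟨𝟭 C⟩
  comp F G := ⟨F.functor ⋙ G.functor⟩

/-- Two parallel additive functors are equal if they agree on objects and morphisms. -/
theorem hom_ext {C D : CatAb.{u}} {F G : C ⟶ D} (hobj : ∀ X, F.functor.obj X = G.functor.obj X)
    (hmap : ∀ (X Y : C) (f : X ⟶ Y), HEq (F.functor.map f) (G.functor.map f)) : F = G :=
  Hom.ext (Functor.hext hobj hmap)

section Structure

variable (C D E : CatAb.{u})

/-- The tensor product of preadditive categories. -/
abbrev tensorObj : CatAb.{u} := ⟨Tens C D⟩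

variable {C D E}

/-- The additive functor out of a tensor product, given on morphisms by additive maps that are
functorial on pure tensors. -/
def homDesc (obj : Tens C D → E) (map : ∀ X Y : Tens C D, (X ⟶ Y) →+ (obj X ⟶ obj Y))
    (map_id : ∀ X : Tens C D, map X X (Tens.tmul (𝟙 _) (𝟙 _)) = 𝟙 (obj X))
    (map_comp : ∀ (X Y Z : Tens C D) (f : X.fst ⟶ Y.fst) (g : X.snd ⟶ Y.snd) (f' : Y.fst ⟶ Z.fst)
      (g' : Y.snd ⟶ Z.snd), map X Z (Tens.tmul (f ≫ f') (g ≫ g')) =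
        map X Y (Tens.tmul f g) ≫ map Y Z (Tens.tmul f' g')) : tensorObj C D ⟶ E :=
  Hom.mk (C := tensorObj C D) (D := E) (Tens.desc obj map map_id map_comp)
    (additive := ⟨fun {X Y f g} => (map X Y).map_add f g⟩)

/-- The tensor product of two additive functors. -/
def tensorMap {C' D' : CatAb.{u}} (F : C ⟶ C') (G : D ⟶ D') : tensorObj C D ⟶ tensorObj C' D' :=
  homDesc (E := tensorObj C' D') (fun X => Tens.mk (F.functor.obj X.fst) (G.functor.obj X.snd))
    (fun X Y => Tens.liftHom (fun f g => Tens.tmul (F.functor.map f) (G.functor.map g))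
      (fun f f' g => by rw [F.functor.map_add]; exact Tens.add_tmul _ _ _)
      (fun f g g' => by rw [G.functor.map_add]; exact Tens.tmul_add _ _ _))
    (fun X => by
      rw [Tens.liftHom_tmul, F.functor.map_id, G.functor.map_id]; rfl)
    (fun X Y Z f g f' g' => by
      rw [Tens.liftHom_tmul, Tens.liftHom_tmul, Tens.liftHom_tmul, F.functor.map_comp,
        G.functor.map_comp]; rfl)

/-- Additive functors out of a tensor product are determined on objects and pure tensors. -/
theorem hom_ext_tensor {F G : tensorObj C D ⟶ E}
    (hobj : ∀ X, F.functor.obj X = G.functor.obj X)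
    (hmap : ∀ (X Y : Tens C D) (f : X.fst ⟶ Y.fst) (g : X.snd ⟶ Y.snd),
      HEq (F.functor.map (Tens.tmul f g : X ⟶ Y)) (G.functor.map (Tens.tmul f g : X ⟶ Y))) :
    F = G := by
  have key : ∀ (X Y : tensorObj C D) (f : X ⟶ Y), F.functor.map f =
      eqToHom (hobj X) ≫ G.functor.map f ≫ eqToHom (hobj Y).symm := by
    intro X Y f
    induction f using Tens.hom_induction with
    | h f g => exact (conj_eqToHom_iff_heq _ _ (hobj X) (hobj Y)).2 (hmap X Y f g)
    | hadd s t hs ht =>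
      refine F.additive.map_add.trans ?_
      rw [hs, ht, ← Preadditive.comp_add, ← Preadditive.add_comp]
      congr 2
      exact G.additive.map_add.symm
  exact Hom.ext (CategoryTheory.Functor.ext hobj key)

/-- The associator on morphism groups. -/
def assocAdd {C D E : CatAb.{u}} (X Y : Tens (tensorObj C D) E) :
    (X ⟶ Y) →+ ((Tens.mk X.fst.fst (Tens.mk X.fst.snd X.snd) : Tens C (tensorObj D E)) ⟶
      Tens.mk Y.fst.fst (Tens.mk Y.fst.snd Y.snd)) :=
  (TensorProduct.assoc ℤ (X.fst.fst ⟶ Y.fst.fst) (X.fst.snd ⟶ Y.fst.snd)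
    (X.snd ⟶ Y.snd)).toLinearMap.toAddMonoidHom

/-- The inverse associator on morphism groups. -/
def assocAddInv {C D E : CatAb.{u}} (X Y : Tens C (tensorObj D E)) :
    (X ⟶ Y) →+ ((Tens.mk (Tens.mk X.fst X.snd.fst) X.snd.snd : Tens (tensorObj C D) E) ⟶
      Tens.mk (Tens.mk Y.fst Y.snd.fst) Y.snd.snd) :=
  (TensorProduct.assoc ℤ (X.fst ⟶ Y.fst) (X.snd.fst ⟶ Y.snd.fst)
    (X.snd.snd ⟶ Y.snd.snd)).symm.toLinearMap.toAddMonoidHom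

/-- The symmetry on morphism groups. -/
def commAdd {C D : CatAb.{u}} (X Y : Tens C D) :
    (X ⟶ Y) →+ ((Tens.mk X.snd X.fst : Tens D C) ⟶ Tens.mk Y.snd Y.fst) :=
  (TensorProduct.comm ℤ (X.fst ⟶ Y.fst) (X.snd ⟶ Y.snd)).toLinearMap.toAddMonoidHom

/-- The associator `(C ⊗ D) ⊗ E ⟶ C ⊗ (D ⊗ E)`. -/
def assocHom (C D E : CatAb.{u}) : tensorObj (tensorObj C D) E ⟶ tensorObj C (tensorObj D E) :=
  homDesc (C := tensorObj C D) (E := tensorObj C (tensorObj D E))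
    (fun X => Tens.mk X.fst.fst (Tens.mk X.fst.snd X.snd))
    assocAdd
    (fun _ => rfl)
    (fun X Y Z f g f' g' => by
      induction f using Tens.hom_induction with
      | hadd s t hs ht =>
        rw [Preadditive.add_comp, Tens.add_tmul, Tens.add_tmul, map_add, map_add, hs, ht,
          Preadditive.add_comp]
      | h a b =>
        induction f' using Tens.hom_induction with
        | hadd s t hs ht =>
          rw [Preadditive.comp_add, Tens.add_tmul, Tens.add_tmul, map_add, map_add, hs, ht,
            Preadditive.comp_add]
        | h a' b' => rfl)

/-- The inverse associator `C ⊗ (D ⊗ E) ⟶ (C ⊗ D) ⊗ E`. -/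
def assocInv (C D E : CatAb.{u}) : tensorObj C (tensorObj D E) ⟶ tensorObj (tensorObj C D) E :=
  homDesc (D := tensorObj D E) (E := tensorObj (tensorObj C D) E)
    (fun X => Tens.mk (Tens.mk X.fst X.snd.fst) X.snd.snd)
    assocAddInv
    (fun _ => rfl)
    (fun X Y Z f g f' g' => by
      induction g using Tens.hom_induction with
      | hadd s t hs ht =>
        rw [Preadditive.add_comp, Tens.tmul_add, Tens.tmul_add, map_add, map_add, hs, ht,
          Preadditive.add_comp]
      | h a b =>
        induction g' using Tens.hom_induction with
        | hadd s t hs ht =>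
          rw [Preadditive.comp_add, Tens.tmul_add, Tens.tmul_add, map_add, map_add, hs, ht,
            Preadditive.comp_add]
        | h a' b' => rfl)

/-- The one-object preadditive category `R̲` as an object of `Cat(Ab)`. -/
abbrev underline (R : Type u) [Ring R] : CatAb.{u} := ⟨OneObj R⟩

/-- The unit `ℤ̲` of the tensor product. -/
abbrev tensorUnit : CatAb.{u} := underline (ULift.{u} ℤ)

/-- The left unitor `ℤ̲ ⊗ C ⟶ C`, `n ⊗ f ↦ n • f`. -/
def leftUnitorHom (C : CatAb.{u}) : tensorObj tensorUnit C ⟶ C :=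
  homDesc (C := tensorUnit) (fun X => X.snd)
    (fun X Y => Tens.liftHom (fun n f => (OneObj.toRing n).down • f)
      (fun n n' f => by rw [map_add, ULift.add_down, add_smul])
      (fun n f f' => smul_add _ _ _))
    (fun X => by rw [Tens.liftHom_tmul, OneObj.toRing_id, ULift.one_down, one_smul])
    (fun X Y Z n f n' f' => by
      rw [Tens.liftHom_tmul, Tens.liftHom_tmul, Tens.liftHom_tmul, OneObj.toRing_comp,
        ULift.mul_down, Preadditive.zsmul_comp, Preadditive.comp_zsmul, mul_smul])

/-- The inverse of the left unitor. -/
def leftUnitorInv (C : CatAb.{u}) : C ⟶ tensorObj tensorUnit C :=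
  Hom.mk (D := tensorObj tensorUnit C)
    { obj := fun X => Tens.mk (OneObj.star _) X
      map := fun f => Tens.tmul (𝟙 (OneObj.star (ULift.{u} ℤ))) f
      map_id := fun _ => rfl
      map_comp := fun f g => by rw [Tens.tmul_comp, Category.id_comp] }
    (additive := ⟨fun {X Y f g} => Tens.tmul_add _ _ _⟩)

/-- The right unitor `C ⊗ ℤ̲ ⟶ C`, `f ⊗ n ↦ n • f`. -/
def rightUnitorHom (C : CatAb.{u}) : tensorObj C tensorUnit ⟶ C :=
  homDesc (D := tensorUnit) (fun X => X.fst)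
    (fun X Y => Tens.liftHom (fun f n => (OneObj.toRing n).down • f)
      (fun f f' n => smul_add _ _ _)
      (fun f n n' => by rw [map_add, ULift.add_down, add_smul]))
    (fun X => by rw [Tens.liftHom_tmul, OneObj.toRing_id, ULift.one_down, one_smul])
    (fun X Y Z f n f' n' => by
      rw [Tens.liftHom_tmul, Tens.liftHom_tmul, Tens.liftHom_tmul, OneObj.toRing_comp,
        ULift.mul_down, Preadditive.zsmul_comp, Preadditive.comp_zsmul, mul_smul])

/-- The inverse of the right unitor. -/
def rightUnitorInv (C : CatAb.{u}) : C ⟶ tensorObj C tensorUnit :=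
  Hom.mk (D := tensorObj C tensorUnit)
    { obj := fun X => Tens.mk X (OneObj.star _)
      map := fun f => Tens.tmul f (𝟙 (OneObj.star (ULift.{u} ℤ)))
      map_id := fun _ => rfl
      map_comp := fun f g => by rw [Tens.tmul_comp, Category.id_comp] }
    (additive := ⟨fun {X Y f g} => Tens.add_tmul _ _ _⟩)

/-- The symmetry `C ⊗ D ⟶ D ⊗ C`, `f ⊗ g ↦ g ⊗ f`. -/
def braidingHom (C D : CatAb.{u}) : tensorObj C D ⟶ tensorObj D C :=
  homDesc (E := tensorObj D C) (fun X => Tens.mk X.snd X.fst)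
    commAdd (fun _ => rfl)
    (fun _ _ _ _ _ _ _ => rfl)

theorem tmul_zsmul {C D : CatAb.{u}} {X Y : Tens C D} (n : ℤ) (f : X.fst ⟶ Y.fst)
    (g : X.snd ⟶ Y.snd) : (Tens.tmul (n • f) g : X ⟶ Y) = Tens.tmul f (n • g) :=
  TensorProduct.smul_tmul n f g

/-- Additive functors out of a triple tensor product are determined on objects and pure tensors. -/
theorem hom_ext_tensor₃ {B : CatAb.{u}} {F G : tensorObj (tensorObj C D) E ⟶ B}
    (hobj : ∀ X, F.functor.obj X = G.functor.obj X)
    (hmap : ∀ (X Y : Tens (tensorObj C D) E) (f : X.fst.fst ⟶ Y.fst.fst)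
      (g : X.fst.snd ⟶ Y.fst.snd) (h : X.snd ⟶ Y.snd),
      HEq (F.functor.map (Tens.tmul (Tens.tmul f g : X.fst ⟶ Y.fst) h : X ⟶ Y))
        (G.functor.map (Tens.tmul (Tens.tmul f g : X.fst ⟶ Y.fst) h : X ⟶ Y))) :
    F = G := by
  refine hom_ext_tensor hobj ?_
  intro X Y s h
  refine (conj_eqToHom_iff_heq _ _ (hobj X) (hobj Y)).1 ?_
  induction s using Tens.hom_induction with
  | h f g => exact (conj_eqToHom_iff_heq _ _ (hobj X) (hobj Y)).2 (hmap X Y f g h)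
  | hadd s t hs ht =>
    rw [Tens.add_tmul]
    refine F.additive.map_add.trans ?_
    rw [hs, ht, ← Preadditive.comp_add, ← Preadditive.add_comp]
    congr 2
    exact G.additive.map_add.symm

/-- Additive functors out of a fourfold tensor product are determined on objects and pure
tensors. -/
theorem hom_ext_tensor₄ {A B : CatAb.{u}} {F G : tensorObj (tensorObj (tensorObj A C) D) E ⟶ B}
    (hobj : ∀ X, F.functor.obj X = G.functor.obj X)
    (hmap : ∀ (X Y : Tens (tensorObj (tensorObj A C) D) E) (k : X.fst.fst.fst ⟶ Y.fst.fst.fst)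
      (f : X.fst.fst.snd ⟶ Y.fst.fst.snd) (g : X.fst.snd ⟶ Y.fst.snd) (h : X.snd ⟶ Y.snd),
      HEq (F.functor.map (Tens.tmul (Tens.tmul (Tens.tmul k f : X.fst.fst ⟶ Y.fst.fst) g :
          X.fst ⟶ Y.fst) h : X ⟶ Y))
        (G.functor.map (Tens.tmul (Tens.tmul (Tens.tmul k f : X.fst.fst ⟶ Y.fst.fst) g :
          X.fst ⟶ Y.fst) h : X ⟶ Y))) :
    F = G := by
  refine hom_ext_tensor₃ hobj ?_
  intro X Y s g h
  refine (conj_eqToHom_iff_heq _ _ (hobj X) (hobj Y)).1 ?_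
  induction s using Tens.hom_induction with
  | h k f => exact (conj_eqToHom_iff_heq _ _ (hobj X) (hobj Y)).2 (hmap X Y k f g h)
  | hadd s t hs ht =>
    rw [Tens.add_tmul, Tens.add_tmul]
    refine F.additive.map_add.trans ?_
    rw [hs, ht, ← Preadditive.comp_add, ← Preadditive.add_comp]
    congr 2
    exact G.additive.map_add.symm

/-- Additive functors out of a triple tensor product, bracketed on the right, are determined on
objects and pure tensors. -/
theorem hom_ext_tensor₃' {B : CatAb.{u}} {F G : tensorObj C (tensorObj D E) ⟶ B}
    (hobj : ∀ X, F.functor.obj X = G.functor.obj X)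
    (hmap : ∀ (X Y : Tens C (tensorObj D E)) (f : X.fst ⟶ Y.fst)
      (g : X.snd.fst ⟶ Y.snd.fst) (h : X.snd.snd ⟶ Y.snd.snd),
      HEq (F.functor.map (Tens.tmul f (Tens.tmul g h : X.snd ⟶ Y.snd) : X ⟶ Y))
        (G.functor.map (Tens.tmul f (Tens.tmul g h : X.snd ⟶ Y.snd) : X ⟶ Y))) :
    F = G := by
  refine hom_ext_tensor hobj ?_
  intro X Y f s
  refine (conj_eqToHom_iff_heq _ _ (hobj X) (hobj Y)).1 ?_
  induction s using Tens.hom_induction with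
  | h g h => exact (conj_eqToHom_iff_heq _ _ (hobj X) (hobj Y)).2 (hmap X Y f g h)
  | hadd s t hs ht =>
    rw [Tens.tmul_add]
    refine F.additive.map_add.trans ?_
    rw [hs, ht, ← Preadditive.comp_add, ← Preadditive.add_comp]
    congr 2
    exact G.additive.map_add.symm

end Structure

/-! ### The closed symmetric monoidal structure of `Cat(Ab)` -/

instance : MonoidalCategoryStruct CatAb.{u} where
  tensorObj := tensorObj
  tensorUnit := tensorUnit
  tensorHom := tensorMap
  whiskerLeft C _ _ F := tensorMap (𝟙 C) F
  whiskerRight F C := tensorMap F (𝟙 C)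
  associator C D E :=
    { hom := assocHom C D E
      inv := assocInv C D E
      hom_inv_id := hom_ext_tensor₃ (fun _ => rfl) (fun _ _ _ _ _ => HEq.rfl)
      inv_hom_id := hom_ext_tensor₃' (fun _ => rfl) (fun _ _ _ _ _ => HEq.rfl) }
  leftUnitor C :=
    { hom := leftUnitorHom C
      inv := leftUnitorInv C
      hom_inv_id := hom_ext_tensor (fun _ => rfl) (fun X Y n f => heq_of_eq <| by
        refine (tmul_zsmul (C := tensorUnit) (X := X) (Y := Y) (OneObj.toRing n).down
          (𝟙 (OneObj.star (ULift.{u} ℤ))) f).symm.trans ?_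
        exact congrArg (fun m => (Tens.tmul m f : X ⟶ Y)) (OneObj.zsmul_id n))
      inv_hom_id := hom_ext (fun _ => rfl) (fun X Y f => heq_of_eq <| one_smul ℤ f) }
  rightUnitor C :=
    { hom := rightUnitorHom C
      inv := rightUnitorInv C
      hom_inv_id := hom_ext_tensor (fun _ => rfl) (fun X Y f n => heq_of_eq <| by
        refine (tmul_zsmul (D := tensorUnit) (X := X) (Y := Y) (OneObj.toRing n).down f
          (𝟙 (OneObj.star (ULift.{u} ℤ)))).trans ?_
        exact congrArg (fun m => (Tens.tmul f m : X ⟶ Y)) (OneObj.zsmul_id n))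
      inv_hom_id := hom_ext (fun _ => rfl) (fun X Y f => heq_of_eq <| one_smul ℤ f) }


theorem heq_comp_map {C D E : CatAb.{u}} (F : C ⟶ D) (G : D ⟶ E) {X Y : C} {f : X ⟶ Y} {X' Y' : D}
    (hX : F.functor.obj X = X') (hY : F.functor.obj Y = Y') {f' : X' ⟶ Y'}
    (hf : HEq (F.functor.map f) f') {X'' Y'' : E} {f'' : X'' ⟶ Y''}
    (hf' : HEq (G.functor.map f') f'') : HEq ((F ≫ G).functor.map f) f'' := by
  subst hX hY
  obtain rfl := eq_of_heq hf
  exact hf'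

theorem pentagon_aux (W X Y Z : CatAb.{u}) :
    tensorMap (assocHom W X Y) (𝟙 Z) ≫ assocHom W (tensorObj X Y) Z ≫
      tensorMap (𝟙 W) (assocHom X Y Z) =
        assocHom (tensorObj W X) Y Z ≫ assocHom W X (tensorObj Y Z) := by
  let obj : Tens (tensorObj (tensorObj W X) Y) Z → Tens W (tensorObj X (tensorObj Y Z)) :=
    fun P => Tens.mk P.fst.fst.fst (Tens.mk P.fst.fst.snd (Tens.mk P.fst.snd P.snd))
  let obj₁ : Tens (tensorObj (tensorObj W X) Y) Z → Tens (tensorObj W (tensorObj X Y)) Z :=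
    fun P => Tens.mk (Tens.mk P.fst.fst.fst (Tens.mk P.fst.fst.snd P.fst.snd)) P.snd
  let obj₂ : Tens (tensorObj (tensorObj W X) Y) Z → Tens W (tensorObj (tensorObj X Y) Z) :=
    fun P => Tens.mk P.fst.fst.fst (Tens.mk (Tens.mk P.fst.fst.snd P.fst.snd) P.snd)
  refine hom_ext_tensor₄ (fun P => Eq.trans (b := obj P) rfl rfl) (fun P Q k f g h => ?_)
  let t : P ⟶ Q := Tens.tmul (X := P) (Y := Q) (Tens.tmul (X := P.fst) (Y := Q.fst)
    (Tens.tmul (X := P.fst.fst) (Y := Q.fst.fst) k f) g) h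
  let v : obj P ⟶ obj Q := Tens.tmul (X := obj P) (Y := obj Q) k
    (Tens.tmul (X := (obj P).snd) (Y := (obj Q).snd) f
      (Tens.tmul (X := (obj P).snd.snd) (Y := (obj Q).snd.snd) g h))
  let v₁ : obj₁ P ⟶ obj₁ Q := Tens.tmul (X := obj₁ P) (Y := obj₁ Q)
    (Tens.tmul (X := (obj₁ P).fst) (Y := (obj₁ Q).fst) k
      (Tens.tmul (X := (obj₁ P).fst.snd) (Y := (obj₁ Q).fst.snd) f g)) h
  let v₂ : obj₂ P ⟶ obj₂ Q := Tens.tmul (X := obj₂ P) (Y := obj₂ Q) k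
    (Tens.tmul (X := (obj₂ P).snd) (Y := (obj₂ Q).snd)
      (Tens.tmul (X := (obj₂ P).snd.fst) (Y := (obj₂ Q).snd.fst) f g) h)
  have h₁ : HEq ((tensorMap (assocHom W X Y) (𝟙 Z)).functor.map t) v₁ := HEq.rfl
  have h₂ : HEq ((assocHom W (tensorObj X Y) Z).functor.map v₁) v₂ := HEq.rfl
  have h₃ : HEq ((tensorMap (𝟙 W) (assocHom X Y Z)).functor.map v₂) v := HEq.rfl
  have h₄ : HEq ((assocHom (tensorObj W X) Y Z ≫ assocHom W X (tensorObj Y Z)).functor.map t) v :=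
    HEq.rfl
  have h₅ := heq_comp_map (assocHom W (tensorObj X Y) Z) (tensorMap (𝟙 W) (assocHom X Y Z))
    (X := obj₁ P) (Y := obj₁ Q) (X' := obj₂ P) (Y' := obj₂ Q) (f := v₁) (f' := v₂)
    (X'' := obj P) (Y'' := obj Q) (f'' := v) rfl rfl h₂ h₃
  have h₆ := heq_comp_map (tensorMap (assocHom W X Y) (𝟙 Z)) (assocHom W (tensorObj X Y) Z ≫
    tensorMap (𝟙 W) (assocHom X Y Z)) (X := P) (Y := Q) (X' := obj₁ P) (Y' := obj₁ Q) (f := t)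
    (f' := v₁) (X'' := obj P) (Y'' := obj Q) (f'' := v) rfl rfl h₁ h₅
  exact h₆.trans h₄.symm

instance : MonoidalCategory CatAb.{u} :=
  MonoidalCategory.ofTensorHom
    (id_tensorHom_id := fun _ _ => hom_ext_tensor (fun _ => rfl) (fun _ _ _ _ => HEq.rfl))
    (id_tensorHom := fun _ _ _ _ => rfl)
    (tensorHom_id := fun _ _ => rfl)
    (tensorHom_comp_tensorHom := fun _ _ _ _ =>
      hom_ext_tensor (fun _ => rfl) (fun _ _ _ _ => HEq.rfl))
    (associator_naturality := fun _ _ _ =>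
      hom_ext_tensor₃ (fun _ => rfl) (fun _ _ _ _ _ => HEq.rfl))
    (leftUnitor_naturality := fun F => hom_ext_tensor (fun _ => rfl) (fun _ _ n f =>
      heq_of_eq (F.functor.map_zsmul (r := (OneObj.toRing n).down) (f := f)).symm))
    (rightUnitor_naturality := fun F => hom_ext_tensor (fun _ => rfl) (fun _ _ f n =>
      heq_of_eq (F.functor.map_zsmul (r := (OneObj.toRing n).down) (f := f)).symm))
    (pentagon := pentagon_aux)
    (triangle := fun C D => hom_ext_tensor₃ (fun _ => rfl) (fun X Y f n g =>
      heq_of_eq (tmul_zsmul (C := C) (D := D) (X := Tens.mk X.fst.fst X.snd)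
        (Y := Tens.mk Y.fst.fst Y.snd) (OneObj.toRing n).down f g).symm))


theorem hexagon_forward_aux (X Y Z : CatAb.{u}) :
    assocHom X Y Z ≫ braidingHom X (tensorObj Y Z) ≫ assocHom Y Z X =
      tensorMap (braidingHom X Y) (𝟙 Z) ≫ assocHom Y X Z ≫
        tensorMap (𝟙 Y) (braidingHom X Z) :=
  hom_ext_tensor₃ (fun _ => rfl) (fun _ _ _ _ _ => HEq.rfl)

theorem hexagon_reverse_aux (X Y Z : CatAb.{u}) :
    assocInv X Y Z ≫ braidingHom (tensorObj X Y) Z ≫ assocInv Z X Y =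
      tensorMap (𝟙 X) (braidingHom Y Z) ≫ assocInv X Z Y ≫ tensorMap (braidingHom X Z) (𝟙 Y) :=
  hom_ext_tensor₃' (fun _ => rfl) (fun _ _ _ _ _ => HEq.rfl)

instance : SymmetricCategory CatAb.{u} where
  braiding C D :=
    { hom := braidingHom C D
      inv := braidingHom D C
      hom_inv_id := hom_ext_tensor (fun _ => rfl) (fun _ _ _ _ => HEq.rfl)
      inv_hom_id := hom_ext_tensor (fun _ => rfl) (fun _ _ _ _ => HEq.rfl) }
  braiding_naturality_right _ _ _ _ := hom_ext_tensor (fun _ => rfl) (fun _ _ _ _ => HEq.rfl)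
  braiding_naturality_left _ _ := hom_ext_tensor (fun _ => rfl) (fun _ _ _ _ => HEq.rfl)
  hexagon_forward := hexagon_forward_aux
  hexagon_reverse := hexagon_reverse_aux
  symmetry _ _ := hom_ext_tensor (fun _ => rfl) (fun _ _ _ _ => HEq.rfl)

section InternalHom

variable (C : CatAb.{u})

/-- The internal hom `D^C`: its objects are the additive functors `C ⥤ D`, and its morphism groups
are the groups of natural transformations, i.e. the ends `∫ c, D(F c, G c)`. -/
abbrev internalHom (D : CatAb.{u}) : CatAb.{u} := ⟨C ⥤+ D⟩

variable {C}

/-- Postcomposition with an additive functor. -/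
def internalHomMap {D E : CatAb.{u}} (F : D ⟶ E) : internalHom C D ⟶ internalHom C E :=
  Hom.mk (C := internalHom C D) (D := internalHom C E)
    { obj := fun H => ⟨H.obj ⋙ F.functor, (inferInstance : (H.obj ⋙ F.functor).Additive)⟩
      map := fun α => ⟨Functor.whiskerRight α.hom F.functor⟩
      map_id := fun H => by
        ext c
        exact F.functor.map_id (H.obj.obj c)
      map_comp := fun α β => by
        ext c
        exact F.functor.map_comp (α.hom.app c) (β.hom.app c) }
    (additive := ⟨fun {H K α β} => by
      ext c
      exact F.additive.map_add (f := α.hom.app c) (g := β.hom.app c)⟩)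

theorem map_tmul_comp {D E : CatAb.{u}} (F : tensorObj C D ⟶ E) {c c' c'' : C} {d d' d'' : D}
    (f : c ⟶ c') (f' : c' ⟶ c'') (g : d ⟶ d') (g' : d' ⟶ d'') :
    F.functor.map (Tens.tmul f g : (Tens.mk c d : Tens C D) ⟶ Tens.mk c' d') ≫
      F.functor.map (Tens.tmul f' g' : (Tens.mk c' d' : Tens C D) ⟶ Tens.mk c'' d'') =
      F.functor.map (Tens.tmul (f ≫ f') (g ≫ g') :
        (Tens.mk c d : Tens C D) ⟶ Tens.mk c'' d'') :=
  (F.functor.map_comp _ _).symm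

theorem map_tmul_add {D E : CatAb.{u}} (F : tensorObj C D ⟶ E) {c c' : C} {d d' : D}
    (f : c ⟶ c') (g g' : d ⟶ d') :
    F.functor.map (Tens.tmul f (g + g') : (Tens.mk c d : Tens C D) ⟶ Tens.mk c' d') =
      F.functor.map (Tens.tmul f g : (Tens.mk c d : Tens C D) ⟶ Tens.mk c' d') +
      F.functor.map (Tens.tmul f g' : (Tens.mk c d : Tens C D) ⟶ Tens.mk c' d') := by
  rw [Tens.tmul_add]
  exact F.additive.map_add

theorem map_add_tmul {D E : CatAb.{u}} (F : tensorObj C D ⟶ E) {c c' : C} {d d' : D}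
    (f f' : c ⟶ c') (g : d ⟶ d') :
    F.functor.map (Tens.tmul (f + f') g : (Tens.mk c d : Tens C D) ⟶ Tens.mk c' d') =
      F.functor.map (Tens.tmul f g : (Tens.mk c d : Tens C D) ⟶ Tens.mk c' d') +
      F.functor.map (Tens.tmul f' g : (Tens.mk c d : Tens C D) ⟶ Tens.mk c' d') := by
  rw [Tens.add_tmul]
  exact F.additive.map_add

/-- The functor `D ⟶ E^C` corresponding to a functor `C ⊗ D ⟶ E`. -/
def curryHom {D E : CatAb.{u}} (F : tensorObj C D ⟶ E) : D ⟶ internalHom C E :=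
  Hom.mk (D := internalHom C E)
    { obj := fun d =>
        ⟨{ obj := fun c => F.functor.obj (Tens.mk c d)
           map := fun {c c'} f => F.functor.map
            (Tens.tmul f (𝟙 d) : (Tens.mk c d : Tens C D) ⟶ Tens.mk c' d)
           map_id := fun c => F.functor.map_id (Tens.mk c d)
           map_comp := fun f f' => by rw [map_tmul_comp, Category.comp_id] },
          ⟨fun {c c' f f'} => map_add_tmul F f f' (𝟙 d)⟩⟩
      map := fun {d d'} g =>
        ⟨{ app := fun c => F.functor.map
            (Tens.tmul (𝟙 c) g : (Tens.mk c d : Tens C D) ⟶ Tens.mk c d')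
           naturality := fun c c' f => by
            rw [map_tmul_comp, map_tmul_comp, Category.comp_id, Category.comp_id, Category.id_comp,
              Category.id_comp] }⟩
      map_id := fun d => by
        ext c
        exact F.functor.map_id (Tens.mk c d)
      map_comp := fun {d d' d''} g g' => by
        ext c
        refine Eq.trans ?_ (map_tmul_comp F (𝟙 c) (𝟙 c) g g').symm
        rw [Category.comp_id] }
    (additive := ⟨fun {d d' g g'} => by
      ext c
      exact map_tmul_add F (𝟙 c) g g'⟩)

/-- The functor `C ⊗ D ⟶ E` corresponding to a functor `D ⟶ E^C`. -/
def uncurryHom {D E : CatAb.{u}} (G : D ⟶ internalHom C E) : tensorObj C D ⟶ E :=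
  homDesc (fun X => (G.functor.obj X.snd).obj.obj X.fst)
    (fun X Y => Tens.liftHom
      (fun f g => (G.functor.obj X.snd).obj.map f ≫ (G.functor.map g).hom.app Y.fst)
      (fun f f' g => by rw [Functor.map_add, Preadditive.add_comp])
      (fun f g g' => by
        refine Eq.trans ?_ (Preadditive.comp_add _ _ _ _ _ _)
        exact congrArg (fun α : G.functor.obj X.snd ⟶ G.functor.obj Y.snd =>
          (G.functor.obj X.snd).obj.map f ≫ α.hom.app Y.fst) G.additive.map_add))
    (fun X => by
      rw [Tens.liftHom_tmul, CategoryTheory.Functor.map_id, CategoryTheory.Functor.map_id,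
        Category.id_comp]
      rfl)
    (fun X Y Z f g f' g' => by
      rw [Tens.liftHom_tmul, Tens.liftHom_tmul, Tens.liftHom_tmul, Functor.map_comp,
        Functor.map_comp]
      change (_ ≫ _) ≫ (G.functor.map g).hom.app _ ≫ (G.functor.map g').hom.app _ = _
      rw [Category.assoc, Category.assoc, NatTrans.naturality_assoc])

theorem heq_app {E : CatAb.{u}} {F G F' G' : C ⥤+ E} (hF : F = F') (hG : G = G') {α : F ⟶ G}
    {β : F' ⟶ G'} (h : ∀ c, HEq (α.hom.app c) (β.hom.app c)) : HEq α β := by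
  subst hF hG
  refine heq_of_eq ?_
  ext c
  exact eq_of_heq (h c)

theorem curryHom_uncurryHom {D E : CatAb.{u}} (G : D ⟶ internalHom C E) :
    curryHom (uncurryHom G) = G := by
  have hobj : ∀ d : D, (curryHom (uncurryHom G)).functor.obj d = G.functor.obj d := by
    intro d
    refine ObjectProperty.FullSubcategory.ext (Functor.hext (fun _ => rfl) fun c c' f =>
      heq_of_eq ?_)
    change (G.functor.obj d).obj.map f ≫ (G.functor.map (𝟙 d)).hom.app c' = _
    rw [CategoryTheory.Functor.map_id]
    exact Category.comp_id _
  refine hom_ext hobj fun d d' g => heq_app (hobj d) (hobj d') fun c => heq_of_eq ?_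
  change (G.functor.obj d).obj.map (𝟙 c) ≫ (G.functor.map g).hom.app c = _
  rw [CategoryTheory.Functor.map_id]
  exact Category.id_comp _

theorem uncurryHom_curryHom {D E : CatAb.{u}} (F : tensorObj C D ⟶ E) :
    uncurryHom (curryHom F) = F :=
  hom_ext_tensor (fun _ => rfl) (fun X Y f g => heq_of_eq <|
    (map_tmul_comp F f (𝟙 _) (𝟙 _) g).trans (by rw [Category.comp_id, Category.id_comp]))

end InternalHom

instance : MonoidalClosed CatAb.{u} where
  closed C :=
    { rightAdj :=
        { obj := internalHom C
          map := internalHomMap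
          map_id := fun _ => hom_ext (fun _ => rfl) (fun _ _ _ => HEq.rfl)
          map_comp := fun _ _ => hom_ext (fun _ => rfl) (fun _ _ _ => HEq.rfl) }
      adj := Adjunction.mkOfHomEquiv
        { homEquiv := fun _ _ =>
            { toFun := curryHom
              invFun := uncurryHom
              left_inv := uncurryHom_curryHom
              right_inv := curryHom_uncurryHom }
          homEquiv_naturality_left_symm := fun _ _ =>
            hom_ext_tensor (fun _ => rfl) (fun _ _ _ _ => HEq.rfl)
          homEquiv_naturality_right := fun _ _ =>
            hom_ext (fun _ => rfl) (fun _ _ _ => HEq.rfl) } }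

/-! ### The monoid `R̲` in `Cat(Ab)` -/

section Underline

variable (R : Type u) [CommRing R]

/-- The unit `ℤ̲ ⟶ R̲`. -/
def underlineOne : tensorUnit.{u} ⟶ underline R :=
  Hom.mk (C := tensorUnit) (D := underline R)
    { obj := fun _ => OneObj.star R
      map := fun n => OneObj.ofRing (((OneObj.toRing n).down : ℤ) : R)
      map_id := fun _ => Int.cast_one (R := R)
      map_comp := fun m n => Int.cast_mul (α := R) (OneObj.toRing m).down (OneObj.toRing n).down }
    (additive := ⟨fun {_ _ m n} =>
      Int.cast_add (R := R) (OneObj.toRing m).down (OneObj.toRing n).down⟩)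

/-- The multiplication `R̲ ⊗ R̲ ⟶ R̲`, `r ⊗ s ↦ r * s`. -/
def underlineMul : tensorObj (underline R) (underline R) ⟶ underline R :=
  homDesc (C := underline R) (D := underline R) (E := underline R) (fun _ => OneObj.star R)
    (fun _ _ => Tens.liftHom
      (fun r s => OneObj.ofRing (OneObj.toRing r * OneObj.toRing s))
      (fun r r' s => by rw [map_add, add_mul, map_add])
      (fun r s s' => by rw [map_add, mul_add, map_add]))
    (fun _ => mul_one (1 : R))
    (fun _ _ _ r s r' s' =>
      mul_mul_mul_comm (OneObj.toRing r) (OneObj.toRing r') (OneObj.toRing s) (OneObj.toRing s'))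

/-- The monoid structure of `R̲` in `Cat(Ab)`, for a commutative ring `R`. -/
instance : MonObj (underline R) where
  one := underlineOne R
  mul := underlineMul R
  one_mul := hom_ext_tensor (fun _ => rfl) (fun _ _ n r => heq_of_eq
    (zsmul_eq_mul (OneObj.toRing r) (OneObj.toRing n).down).symm)
  mul_one := hom_ext_tensor (fun _ => rfl) (fun _ _ r n => heq_of_eq
    ((zsmul_eq_mul (OneObj.toRing r) (OneObj.toRing n).down).trans (mul_comm _ _)).symm)
  mul_assoc := hom_ext_tensor₃ (fun _ => rfl) (fun _ _ r s t => heq_of_eq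
    (mul_assoc (OneObj.toRing r) (OneObj.toRing s) (OneObj.toRing t)))

instance : IsCommMonObj (underline R) where
  mul_comm := hom_ext_tensor (fun _ => rfl) (fun _ _ r s => heq_of_eq
    (mul_comm (OneObj.toRing s) (OneObj.toRing r)))

end Underline

end CatAb

/-! ### Enriched functors and enriched natural transformations -/

section EnrichedFunctors

variable (V : Type*) [Category V] [MonoidalCategory V]

/-- Precomposition `D(Y, Z) ⟶ D(X, Z)` with `f : 𝟙_ V ⟶ D(X, Y)`. -/
def ePrecomp {D : Type*} [EnrichedCategory V D] {X Y : D} (f : 𝟙_ V ⟶ (X ⟶[V] Y)) (Z : D) :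
    (Y ⟶[V] Z) ⟶ (X ⟶[V] Z) :=
  (λ_ _).inv ≫ f ▷ _ ≫ eComp V X Y Z

/-- Postcomposition `D(X, Y) ⟶ D(X, Z)` with `f : 𝟙_ V ⟶ D(Y, Z)`. -/
def ePostcomp {D : Type*} [EnrichedCategory V D] (X : D) {Y Z : D} (f : 𝟙_ V ⟶ (Y ⟶[V] Z)) :
    (X ⟶[V] Y) ⟶ (X ⟶[V] Z) :=
  (ρ_ _).inv ≫ _ ◁ f ≫ eComp V X Y Z

/-- The composite `𝟙_ V ⟶ D(X, Z)` of `f : 𝟙_ V ⟶ D(X, Y)` and `g : 𝟙_ V ⟶ D(Y, Z)`. -/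
def eCompUnit {D : Type*} [EnrichedCategory V D] {X Y Z : D} (f : 𝟙_ V ⟶ (X ⟶[V] Y))
    (g : 𝟙_ V ⟶ (Y ⟶[V] Z)) : 𝟙_ V ⟶ (X ⟶[V] Z) :=
  (λ_ (𝟙_ V)).inv ≫ (f ⊗ₘ g) ≫ eComp V X Y Z

section

variable {D : Type*} [EnrichedCategory V D]

theorem ePrecomp_eId (X Z : D) : ePrecomp V (eId V X) Z = 𝟙 _ := by
  simp [ePrecomp]

theorem ePostcomp_eId (X Y : D) : ePostcomp V X (eId V Y) = 𝟙 _ := by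
  simp [ePostcomp]

theorem ePrecomp_eCompUnit {X Y Z : D} (f : 𝟙_ V ⟶ (X ⟶[V] Y)) (g : 𝟙_ V ⟶ (Y ⟶[V] Z)) (W : D) :
    ePrecomp V (eCompUnit V f g) W = ePrecomp V g W ≫ ePrecomp V f W :=
  (congrArg (fun k => ePrecomp V k W) (Category.assoc _ _ _).symm).trans <|
    eHomWhiskerRight_comp V (C := ForgetEnrichment V D) (X := X) (X' := Y) (X'' := Z) f g W

theorem ePostcomp_eCompUnit (W : D) {X Y Z : D} (f : 𝟙_ V ⟶ (X ⟶[V] Y)) (g : 𝟙_ V ⟶ (Y ⟶[V] Z)) :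
    ePostcomp V W (eCompUnit V f g) = ePostcomp V W f ≫ ePostcomp V W g :=
  (congrArg (ePostcomp V W) (Category.assoc _ _ _).symm).trans <|
    eHomWhiskerLeft_comp V (C := ForgetEnrichment V D) W (Y := X) (Y' := Y) (Y'' := Z) f g

theorem ePostcomp_ePrecomp {X Y Z W : D} (f : 𝟙_ V ⟶ (X ⟶[V] Y)) (g : 𝟙_ V ⟶ (Z ⟶[V] W)) :
    ePostcomp V Y g ≫ ePrecomp V f W = ePrecomp V f Z ≫ ePostcomp V X g :=
  eHom_whisker_exchange V (C := ForgetEnrichment V D) (X := X) (X' := Y) (Y := Z) (Y' := W) f g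

theorem eId_eCompUnit {X Y : D} (f : 𝟙_ V ⟶ (X ⟶[V] Y)) : eCompUnit V (eId V X) f = f := by
  simp [eCompUnit, MonoidalCategory.tensorHom_def']

theorem eCompUnit_eId {X Y : D} (f : 𝟙_ V ⟶ (X ⟶[V] Y)) : eCompUnit V f (eId V Y) = f := by
  simp [eCompUnit, MonoidalCategory.tensorHom_def, unitors_inv_equal]

theorem eCompUnit_eq {X Y Z : D} (f : 𝟙_ V ⟶ (X ⟶[V] Y)) (g : 𝟙_ V ⟶ (Y ⟶[V] Z)) :
    eCompUnit V f g = f ≫ ePostcomp V X g := by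
  simp [eCompUnit, ePostcomp, MonoidalCategory.tensorHom_def, unitors_inv_equal]

theorem eCompUnit_assoc {X Y Z W : D} (f : 𝟙_ V ⟶ (X ⟶[V] Y)) (g : 𝟙_ V ⟶ (Y ⟶[V] Z))
    (h : 𝟙_ V ⟶ (Z ⟶[V] W)) :
    eCompUnit V (eCompUnit V f g) h = eCompUnit V f (eCompUnit V g h) := by
  rw [eCompUnit_eq V (eCompUnit V f g), eCompUnit_eq V f g, eCompUnit_eq V f,
    ePostcomp_eCompUnit, Category.assoc]

end

variable (C D : Type*) [EnrichedCategory V C] [EnrichedCategory V D]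

/-- The objects of the category of `V`-enriched functors from `C` to `D`, see `EnrichedNat`. -/
structure EnrichedFun where
  /-- The underlying enriched functor. -/
  functor : EnrichedFunctor V C D

variable {V C D}

/-- A `V`-enriched natural transformation from `F` to `G`: a family of morphisms
`α_X : 𝟙_ V ⟶ D(F X, G X)` such that the two morphisms `C(X, Y) ⟶ D(F X, G Y)`, given by `F` and
postcomposition with `α_Y` and by `G` and precomposition with `α_X`, agree. (The type
`EnrichedNatTrans` only has naturality for morphisms `𝟙_ V ⟶ C(X, Y)`, which is weaker.) -/
@[ext]
structure EnrichedNat (F G : EnrichedFun V C D) where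
  app (X : C) : 𝟙_ V ⟶ (F.functor.obj X ⟶[V] G.functor.obj X)
  naturality (X Y : C) :
    F.functor.map X Y ≫ ePostcomp V (F.functor.obj X) (app Y) =
      G.functor.map X Y ≫ ePrecomp V (app X) (G.functor.obj Y)

instance : Category (EnrichedFun V C D) where
  Hom F G := EnrichedNat F G
  id F :=
    { app := fun X => eId V (F.functor.obj X)
      naturality := fun X Y => by rw [ePostcomp_eId, ePrecomp_eId] }
  comp α β :=
    { app := fun X => eCompUnit V (α.app X) (β.app X)
      naturality := fun X Y => by
        rw [ePostcomp_eCompUnit, ePrecomp_eCompUnit, ← Category.assoc, α.naturality,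
          Category.assoc, ← ePostcomp_ePrecomp, ← Category.assoc, β.naturality, Category.assoc] }
  id_comp α := EnrichedNat.ext (funext fun X => eId_eCompUnit V (α.app X))
  comp_id α := EnrichedNat.ext (funext fun X => eCompUnit_eId V (α.app X))
  assoc α β γ := EnrichedNat.ext (funext fun X => eCompUnit_assoc V (α.app X) (β.app X) (γ.app X))

end EnrichedFunctors

/-! ### The one-object enriched category of a monoid -/

/-- The `V`-enriched category with a single object attached to a monoid `M` in a monoidal
category `V`: its only hom-object is `M`, its composition is the multiplication of `M`. -/
def EnrichedOneObj {V : Type*} [Category V] [MonoidalCategory V] (_M : V) : Type := PUnit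

namespace EnrichedOneObj

variable {V : Type*} [Category V] [MonoidalCategory V] (M : V)

/-- The object of the one-object enriched category. -/
def star : EnrichedOneObj M := PUnit.unit

instance [MonObj M] : EnrichedCategory V (EnrichedOneObj M) where
  Hom _ _ := M
  id _ := MonObj.one
  comp _ _ _ := MonObj.mul
  id_comp _ _ := by simp
  comp_id _ _ := by simp
  assoc _ _ _ _ := by simp

end EnrichedOneObj

/-! ### The two categories, and transposition -/

open scoped CategoryTheory.MonoidalClosed

namespace CatAb

variable (R : Type u) [CommRing R]

/-- The category of `Cat(Ab)`-enriched functors from the one-object `Cat(Ab)`-enriched category of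
the monoid `R̲` to `Cat(Ab)`, which is enriched in itself by its internal hom. The morphisms are the
`Cat(Ab)`-enriched natural transformations. -/
abbrev FunDoubleUnderline : Type (u + 1) :=
  EnrichedFun CatAb.{u} (EnrichedOneObj (underline R)) CatAb.{u}

/-- The category of left `R̲`-module objects of `Cat(Ab)`. -/
abbrev LModUnderline : Type (u + 1) := Mod CatAb.{u} (underline R)

variable {R}

/-- The transpose `M ⟶ B^A` of `m : M ⊗ A ⟶ B` under the adjunction `- ⊗ A ⊣ (-)^A`. -/
def transpose {M A B : CatAb.{u}} (m : M ⊗ A ⟶ B) : M ⟶ (ihom A).obj B :=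
  MonoidalClosed.curry ((β_ A M).hom ≫ m)

/-- The action `R̲ ⊗ A ⟶ A` of a module object. -/
def LModUnderline.action (A : LModUnderline R) : underline R ⊗ A.X ⟶ A.X :=
  ModObj.smul (M := underline R) (X := A.X)

/-- The value `F(*)` of an enriched functor at the only object. -/
def FunDoubleUnderline.value (F : FunDoubleUnderline R) : CatAb.{u} :=
  F.functor.obj (EnrichedOneObj.star _)

/-- The map `R̲ ⟶ F(*)^F(*)` of an enriched functor. -/
def FunDoubleUnderline.homMap (F : FunDoubleUnderline R) :
    underline R ⟶ (ihom F.value).obj F.value :=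
  F.functor.map (EnrichedOneObj.star _) (EnrichedOneObj.star _)

/-- The additive functor `F(*) ⟶ G(*)` which corresponds to the only component
`ℤ̲ ⟶ G(*)^F(*)` of an enriched natural transformation. -/
def FunDoubleUnderline.component {F G : FunDoubleUnderline R} (α : F ⟶ G) : F.value ⟶ G.value :=
  MonoidalClosed.uncurry' (α.app (EnrichedOneObj.star _))

end CatAb

end

/-!
The equivalence holds for every commutative monoid `M` in a braided monoidal closed category `V`, and
is proved in that generality: see `EnrichedOneObj.modEquivalence`. The statement is the case
`V = Cat(Ab)`, `M = R̲`.

An enriched functor `F` from the one-object enriched category of `M` to `V` consists of an object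
`A` and a morphism `M ⟶ A^A` that preserves identity and composition. By the adjunction between
`A ⊗ -` and `(-)^A`, combined with the braiding, such a morphism is the transpose of a morphism
`m : M ⊗ A ⟶ A` (`transposeEquiv`). Preservation of the identity is unitality of `m`
(`one_comp_transposeEquiv_iff`). Preservation of composition says that `m` is a right action, since
the self-enrichment composes in diagrammatic order; as `M` is commutative, this is the associativity
of a left action (`mul_comp_transposeEquiv_iff`). The only component `𝟙_ V ⟶ B^A` of an enriched
natural transformation names a morphism `f : A ⟶ B`; postcomposition and precomposition with the
component are `f^A` and `B^f` (`ePostcomp_self`, `ePrecomp_self`), so naturality says that `f` commutes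
with the actions (`transposeEquiv_comp_iff`).

Both constructions keep the underlying object, and they are inverse to each other on structure
morphisms, so the unit and the counit of the equivalence are given by identity morphisms.
-/

open MonObj MonoidalClosed
open scoped CategoryTheory.MonoidalClosed

/-! ### Transposition and module structures -/

section Transpose

section

variable {V : Type*} [Category V] [MonoidalCategory V]

-- The identities and the `eqToHom`s of the next three lemmas are applied below to objects that agree
-- only after unfolding definitions, where rewriting fails.

theorem comp_id_eq_whiskerLeft_id_comp {M A B : V} {m n : M ⊗ A ⟶ B} (h : m = n) :
    m ≫ 𝟙 B = M ◁ 𝟙 A ≫ n := by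
  simp [h]

theorem whiskerLeft_eqToHom_comp_eqToHom {M A : V} (h h' : A = A) (m : M ⊗ A ⟶ A) :
    M ◁ eqToHom h ≫ m ≫ eqToHom h' = m := by
  simp

omit [MonoidalCategory V] in
theorem eqToHom_comp_comp_eqToHom {A B : V} (h : A = A) (h' : B = B) (f : A ⟶ B) :
    eqToHom h ≫ f ≫ eqToHom h' = f := by
  simp

end

variable {V : Type*} [Category V] [MonoidalCategory V] [MonoidalClosed V] [BraidedCategory V]

/-- The bijection between morphisms `M ⊗ A ⟶ B` and morphisms `M ⟶ B^A` of a braided monoidal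
closed category. The internal hom is right adjoint to `A ⊗ -`, so the braiding comes first. -/
def transposeEquiv (M A B : V) : (M ⊗ A ⟶ B) ≃ (M ⟶ (ihom A).obj B) where
  toFun m := curry ((β_ A M).hom ≫ m)
  invFun f := (β_ A M).inv ≫ uncurry f
  left_inv m := by simp
  right_inv f := by simp

theorem transposeEquiv_apply {M A B : V} (m : M ⊗ A ⟶ B) :
    transposeEquiv M A B m = curry ((β_ A M).hom ≫ m) := rfl

theorem whiskerLeft_transposeEquiv_ev {M A B : V} (m : M ⊗ A ⟶ B) :
    A ◁ transposeEquiv M A B m ≫ (ihom.ev A).app B = (β_ A M).hom ≫ m :=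
  whiskerLeft_curry_ihom_ev_app _ _ _

/-- An action is unital if and only if its transpose preserves the identity. -/
theorem one_comp_transposeEquiv_iff {M A : V} [MonObj M] (m : M ⊗ A ⟶ A) :
    η ≫ transposeEquiv M A A m = MonoidalClosed.id A ↔ η ▷ A ≫ m = (λ_ A).hom := by
  rw [transposeEquiv_apply, MonoidalClosed.id_eq, ← curry_natural_left,
    MonoidalClosed.curry_injective.eq_iff,
    BraidedCategory.braiding_naturality_right_assoc, ← braiding_leftUnitor, cancel_epi]

/-- An action is associative if and only if its transpose preserves composition. Composition in
the self-enrichment is written in diagrammatic order, so that preserving it means that `r * s`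
acts as `r` followed by `s`; commutativity turns this right action into a left action. -/
theorem mul_comp_transposeEquiv_iff {M A : V} [MonObj M] [IsCommMonObj M] (m : M ⊗ A ⟶ A) :
    μ ≫ transposeEquiv M A A m =
        (transposeEquiv M A A m ⊗ₘ transposeEquiv M A A m) ≫ comp A A A ↔
      μ ▷ A ≫ m = (α_ M M A).hom ≫ M ◁ m ≫ m := by
  -- Both sides become transposes of morphisms out of `A ⊗ (M ⊗ M)` that first move `A` to the right
  -- and swap the two factors `M`; in `hl` the swap is inserted by commutativity of `μ`.
  have hl : μ ≫ transposeEquiv M A A m =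
      curry ((β_ A (M ⊗ M)).hom ≫ (β_ M M).hom ▷ A ≫ μ ▷ A ≫ m) := by
    rw [transposeEquiv_apply, ← curry_natural_left,
      BraidedCategory.braiding_naturality_right_assoc, ← comp_whiskerRight_assoc,
      IsCommMonObj.mul_comm]
  have hr : (transposeEquiv M A A m ⊗ₘ transposeEquiv M A A m) ≫ comp A A A =
      curry ((β_ A (M ⊗ M)).hom ≫ (β_ M M).hom ▷ A ≫ (α_ M M A).hom ≫ M ◁ m ≫ m) := by
    rw [comp_eq, ← curry_natural_left, compTranspose_eq, MonoidalCategory.tensorHom_def,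
      MonoidalCategory.whiskerLeft_comp, Category.assoc, associator_inv_naturality_right_assoc,
      whisker_exchange_assoc]
    erw [whiskerLeft_transposeEquiv_ev]
    rw [associator_inv_naturality_middle_assoc, ← comp_whiskerRight_assoc]
    erw [whiskerLeft_transposeEquiv_ev]
    rw [comp_whiskerRight_assoc, BraidedCategory.braiding_naturality_left_assoc]
    simp
  rw [hl, hr, MonoidalClosed.curry_injective.eq_iff, cancel_epi, cancel_epi]

/-- A morphism commutes with two actions if and only if postcomposition and precomposition with it
agree on their transposes. -/
theorem transposeEquiv_comp_iff {M A B : V} (m : M ⊗ A ⟶ A) (n : M ⊗ B ⟶ B) (f : A ⟶ B) :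
    transposeEquiv M A A m ≫ (ihom A).map f = transposeEquiv M B B n ≫ (pre f).app B ↔
      m ≫ f = M ◁ f ≫ n := by
  rw [transposeEquiv_apply, transposeEquiv_apply, ← curry_natural_right, curry_pre_app,
    MonoidalClosed.curry_injective.eq_iff, BraidedCategory.braiding_naturality_left_assoc,
    Category.assoc, cancel_epi]

end Transpose

/-! ### Enriched functors out of the one-object enriched category of a commutative monoid -/

section SelfEnriched

/- In the self-enrichment, a morphism out of the unit into an internal hom names an ordinary morphism.
Enriched postcomposition, precomposition and composition with names become the corresponding
operations with ordinary morphisms. -/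

variable {V : Type*} [Category V] [MonoidalCategory V] [MonoidalClosed V]

theorem ePostcomp_self (X : V) {Y Z : V} (f : 𝟙_ V ⟶ (ihom Y).obj Z) :
    ePostcomp V X (Y := Y) (Z := Z) f = (ihom X).map (uncurry' f) := by
  rw [← enrichedOrdinaryCategorySelf_eHomWhiskerLeft]
  change _ = ePostcomp V X (curry' (uncurry' f))
  rw [curry'_uncurry']

theorem ePrecomp_self {X Y : V} (f : 𝟙_ V ⟶ (ihom X).obj Y) (Z : V) :
    ePrecomp V (X := X) (Y := Y) f Z = (pre (uncurry' f)).app Z := by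
  rw [← enrichedOrdinaryCategorySelf_eHomWhiskerRight]
  change _ = ePrecomp V (curry' (uncurry' f)) Z
  rw [curry'_uncurry']

theorem uncurry'_eId (X : V) : uncurry' (eId V X) = 𝟙 X :=
  curry'_injective ((curry'_uncurry' _).trans (curry'_id X).symm)

theorem uncurry'_eCompUnit {X Y Z : V} (f : 𝟙_ V ⟶ (ihom X).obj Y) (g : 𝟙_ V ⟶ (ihom Y).obj Z) :
    uncurry' (eCompUnit V (X := X) (Y := Y) (Z := Z) f g) = uncurry' f ≫ uncurry' g :=
  curry'_injective (by
    rw [curry'_uncurry', curry'_comp, curry'_uncurry', curry'_uncurry']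
    rfl)

end SelfEnriched

namespace EnrichedOneObj

variable {V : Type*} [Category V] [MonoidalCategory V] [MonoidalClosed V] [BraidedCategory V]
  {M : V} [MonObj M]

/-- The action of `M` on the value of an enriched functor: the morphism whose transpose is the only
structure morphism of the functor. -/
def action (F : EnrichedFun V (EnrichedOneObj M) V) :
    M ⊗ F.functor.obj (star M) ⟶ F.functor.obj (star M) :=
  (transposeEquiv _ _ _).symm (F.functor.map (star M) (star M))

theorem transposeEquiv_action (F : EnrichedFun V (EnrichedOneObj M) V) :
    transposeEquiv _ _ _ (action F) = F.functor.map (star M) (star M) :=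
  (transposeEquiv _ _ _).apply_symm_apply _

variable [IsCommMonObj M]

/-- The module given by an enriched functor: the value at the only object, with the action
`EnrichedOneObj.action`. -/
def toMod (F : EnrichedFun V (EnrichedOneObj M) V) : Mod V M where
  X := F.functor.obj (star M)
  mod :=
    { smul := action F
      one_smul := (one_comp_transposeEquiv_iff _).1 <| by
        rw [transposeEquiv_action]
        exact F.functor.map_id (star M)
      mul_smul := (mul_comp_transposeEquiv_iff _).1 <| by
        rw [transposeEquiv_action]
        exact F.functor.map_comp (star M) (star M) (star M) }

/-- The enriched functor given by a module: its value is the underlying object, its only structure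
morphism is the transpose of the action. -/
def ofMod (A : Mod V M) : EnrichedFun V (EnrichedOneObj M) V where
  functor :=
    { obj := fun _ => A.X
      map := fun _ _ => transposeEquiv M A.X A.X (ModObj.smul (M := M) (X := A.X))
      map_id := fun _ => (one_comp_transposeEquiv_iff _).2 (ModObj.one_smul (M := M) A.X)
      map_comp := fun _ _ _ => (mul_comp_transposeEquiv_iff _).2 (ModObj.mul_smul (M := M) A.X) }

variable (M) in
/-- The functor from enriched functors to modules, which sends an enriched natural transformation to
the morphism named by its only component. -/
def modFunctor : EnrichedFun V (EnrichedOneObj M) V ⥤ Mod V M where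
  obj := toMod
  map {F G} α := Mod.Hom.mk' (M := toMod F) (N := toMod G) (uncurry' (α.app (star M))) <|
    (transposeEquiv_comp_iff _ _ _).1 <| by
      have h := α.naturality (star M) (star M)
      rw [ePostcomp_self, ePrecomp_self] at h
      erw [transposeEquiv_action, transposeEquiv_action]
      exact h
  map_id F := Mod.hom_ext _ _ (uncurry'_eId _)
  map_comp α β := Mod.hom_ext _ _ (uncurry'_eCompUnit _ _)

variable (M) in
/-- The functor from modules to enriched functors, which sends a morphism of modules to the enriched
natural transformation whose only component names it. -/
def modInverse : Mod V M ⥤ EnrichedFun V (EnrichedOneObj M) V where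
  obj := ofMod
  map {A B} f :=
    { app := fun _ => curry' (X := A.X) (Y := B.X) f.hom
      naturality := fun _ _ => by
        erw [ePostcomp_self, ePrecomp_self, uncurry'_curry']
        exact (transposeEquiv_comp_iff _ _ _).2 f.isModHom.smul_hom }
  map_id A := EnrichedNat.ext (funext fun _ => curry'_id _)
  map_comp f g := EnrichedNat.ext (funext fun _ => curry'_comp _ _)

/-- Passing from an enriched functor to a module and back changes nothing, because the one-object
enriched category has no other object. -/
def ofModToModIso (F : EnrichedFun V (EnrichedOneObj M) V) :
    F ≅ ofMod (toMod F) where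
  hom :=
    { app := fun X => eId V (F.functor.obj X)
      naturality := fun X Y => by
        erw [ePostcomp_eId, ePrecomp_eId, Category.comp_id, Category.comp_id]
        exact (transposeEquiv_action F).symm }
  inv :=
    { app := fun X => eId V (F.functor.obj X)
      naturality := fun X Y => by
        erw [ePostcomp_eId, ePrecomp_eId, Category.comp_id, Category.comp_id]
        exact transposeEquiv_action F }
  hom_inv_id := EnrichedNat.ext (funext fun X => eId_eCompUnit V _)
  inv_hom_id := EnrichedNat.ext (funext fun X => eId_eCompUnit V _)

theorem action_ofMod (A : Mod V M) : action (ofMod A) = ModObj.smul (M := M) (X := A.X) :=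
  (transposeEquiv M A.X A.X).symm_apply_apply _

/-- Passing from a module to an enriched functor and back changes nothing. -/
def toModOfModIso (A : Mod V M) : toMod (ofMod A) ≅ A where
  hom := Mod.Hom.mk' (M := toMod (ofMod A)) (𝟙 A.X) <|
    comp_id_eq_whiskerLeft_id_comp (action_ofMod A)
  inv := Mod.Hom.mk' (N := toMod (ofMod A)) (𝟙 A.X) <|
    comp_id_eq_whiskerLeft_id_comp (action_ofMod A).symm
  hom_inv_id := Mod.hom_ext _ _ (Category.id_comp _)
  inv_hom_id := Mod.hom_ext _ _ (Category.id_comp _)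

variable (M) in
/-- For a commutative monoid `M` of a braided monoidal closed category `V`, the `V`-enriched functors
from the one-object enriched category of `M` to `V` are equivalent to the modules over `M`. -/
def modEquivalence : EnrichedFun V (EnrichedOneObj M) V ≌ Mod V M :=
  CategoryTheory.Equivalence.mk (modFunctor M) (modInverse M)
    (NatIso.ofComponents ofModToModIso fun {F G} α => EnrichedNat.ext (funext fun X => by
      refine (eCompUnit_eId V (α.app X)).trans (Eq.trans ?_ (eId_eCompUnit V _).symm)
      exact (curry'_uncurry' _).symm))
    (NatIso.ofComponents toModOfModIso fun {A B} f => Mod.hom_ext _ _ (by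
      refine (Category.comp_id _).trans (Eq.trans ?_ (Category.id_comp _).symm)
      exact uncurry'_curry' _))

end EnrichedOneObj

theorem mainTheorem2 (R : Type u) [CommRing R] :
    ∃ e : CatAb.FunDoubleUnderline R ≌ CatAb.LModUnderline R,
      (∃ h : ∀ F : CatAb.FunDoubleUnderline R, (e.functor.obj F).X = F.value,
        (∀ F : CatAb.FunDoubleUnderline R,
          F.homMap = CatAb.transpose (CatAb.underline R ◁ eqToHom (h F).symm ≫
            (e.functor.obj F).action ≫ eqToHom (h F))) ∧
        (∀ (F G : CatAb.FunDoubleUnderline R) (α : F ⟶ G),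
          (e.functor.map α).hom =
            eqToHom (h F) ≫ CatAb.FunDoubleUnderline.component α ≫ eqToHom (h G).symm)) ∧
      (∃ h : ∀ A : CatAb.LModUnderline R, (e.inverse.obj A).value = A.X,
        ∀ A : CatAb.LModUnderline R,
          (e.inverse.obj A).homMap = CatAb.transpose (CatAb.underline R ◁ eqToHom (h A) ≫
            A.action ≫ eqToHom (h A).symm)) := by
  refine ⟨EnrichedOneObj.modEquivalence (CatAb.underline R), ⟨fun _ => rfl, fun F => ?_,
    fun F G α => ?_⟩, fun _ => rfl, fun A => ?_⟩
  · refine (EnrichedOneObj.transposeEquiv_action F).symm.trans ?_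
    exact congrArg CatAb.transpose
      (whiskerLeft_eqToHom_comp_eqToHom rfl rfl (EnrichedOneObj.action F)).symm
  · exact (eqToHom_comp_comp_eqToHom rfl rfl (CatAb.FunDoubleUnderline.component α)).symm
  · exact congrArg CatAb.transpose (whiskerLeft_eqToHom_comp_eqToHom rfl rfl A.action).symm
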